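/- Conventions. Let $\Omega\subset\mathbb{C}^n=\mathbb{R}^{2n}$ be open. A $C^m$ defining function for $\Omega$ ($m\ge 1$) is a real-valued $C^m$ function $\rho$ on an open neighborhood $U$ of $\partial\Omega$ with $\{x\in U:\rho(x)<0\}=\Omega\cap U$ and $\nabla\rho\neq 0$ on $\partial\Omega$. It is uniformly $C^m$ if moreover $\operatorname{dist}(\partial\Omega,\partial U)>0$, all derivatives of $\rho$ of order $\le m$ are bounded on $U$, and $\inf_U|\nabla\rho|>0$. A $C^2$ function $\rho$ is plurisubharmonic (respectively strictly plurisubharmonic) on a set $S$ if $\sum_{j,k=1}^n\frac{\partial^2\rho}{\partial z_j\partial\bar z_k}(p)\,t_j\bar t_k\ge 0$ (respectively $>0$) for all $p\in S$ and all $t\in\mathbb{C}^n\setminus\{0\}$. Write $\delta(z)=\operatorname{dist}(z,\partial\Omega)$, with $\delta\equiv+\infty$ if $\partial\Omega=\emptyset$. Theorem. Let $\Omega\subset\mathbb{C}^n$ be an open set with a $C^2$ defining function $r$ and suppose there is a constant $C>0$ such that $$\sum_{j,k=1}^n \frac{\partial^2 r}{\partial z_j\partial\bar z_k}(p)\,t_j\bar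 t_k\ \ge\ C\,|\nabla r(p)|\sum_{j=1}^n|t_j|^2$$ for every $p\in\partial\Omega$ and every complex tangent vector $t$ at $p$, i.e. every $t\in\mathbb{C}^n$ with $\sum_{j=1}^n\frac{\partial r}{\partial z_j}(p)\,t_j=0$. (1) If $\Omega$ admits a uniformly $C^2$ defining function, then there exists a $C^2$ defining function for $\Omega$ which is strictly plurisubharmonic on $\partial\Omega$. (2) If $\Omega$ admits a uniformly $C^3$ defining function, then there exist a $C^3$ defining function for $\Omega$, defined on an open set containing $\overline\Omega$, and a number $\varepsilon>0$ such that this function is plurisubharmonic on $\Omega$ and strictly plurisubharmonic on $\{z\in\Omega:\delta(z)<\varepsilon\}$. -/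

import Mathlib

open scoped ComplexConjugate

/-- `ρ`, defined on the open neighborhood `U` of `∂Ω`, is a `C^m` defining function for `Ω`.
The values of `ρ` outside `U` are irrelevant. -/
structure IsDefiningFunction {E : Type*} [NormedAddCommGroup E] [NormedSpace ℝ E]
    (m : ℕ) (Ω U : Set E) (ρ : E → ℝ) : Prop where
  isOpen : IsOpen U
  frontier_subset : frontier Ω ⊆ U
  contDiffOn : ContDiffOn ℝ m ρ U
  neg_eq : {x | x ∈ U ∧ ρ x < 0} = Ω ∩ U
  fderiv_ne_zero : ∀ x ∈ frontier Ω, fderiv ℝ ρ x ≠ 0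

/-- A `C^m` defining function `ρ` on `U` is uniformly `C^m` if `dist (∂Ω, ∂U) > 0`, all derivatives
of order at most `m` are bounded on `U`, and `|∇ρ|` is bounded below on `U` by a positive constant.
On a Euclidean space `‖fderiv ℝ ρ x‖` is the Euclidean length of the gradient `∇ρ(x)`. -/
structure IsUniformDefiningFunction {E : Type*} [NormedAddCommGroup E] [NormedSpace ℝ E]
    (m : ℕ) (Ω U : Set E) (ρ : E → ℝ) : Prop extends IsDefiningFunction m Ω U ρ where
  dist_pos : ∃ η > 0, ∀ x ∈ frontier Ω, ∀ y ∈ frontier U, η ≤ dist x y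
  bounded : ∃ M : ℝ, ∀ k ≤ m, ∀ x ∈ U, ‖iteratedFDeriv ℝ k ρ x‖ ≤ M
  gradient_bound : ∃ c > 0, ∀ x ∈ U, c ≤ ‖fderiv ℝ ρ x‖

noncomputable section

/-- `∂f/∂z_j = (∂f/∂x_j - i ∂f/∂y_j) / 2`, where `z_j = x_j + i y_j`. -/
def dz {n : ℕ} (j : Fin n) (f : EuclideanSpace ℂ (Fin n) → ℂ) (p : EuclideanSpace ℂ (Fin n)) : ℂ :=
  (fderiv ℝ f p (EuclideanSpace.single j 1)
    - Complex.I * fderiv ℝ f p (EuclideanSpace.single j Complex.I)) / 2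

/-- `∂f/∂z̄_j = (∂f/∂x_j + i ∂f/∂y_j) / 2`, where `z_j = x_j + i y_j`. -/
def dzbar {n : ℕ} (j : Fin n) (f : EuclideanSpace ℂ (Fin n) → ℂ)
    (p : EuclideanSpace ℂ (Fin n)) : ℂ :=
  (fderiv ℝ f p (EuclideanSpace.single j 1)
    + Complex.I * fderiv ℝ f p (EuclideanSpace.single j Complex.I)) / 2

/-- The Levi form `∑ j k, ∂²r/∂z_j∂z̄_k (p) t_j t̄_k`. The sum is a real number whenever `r` is `C²`
near `p`; the real part only turns it into an element of `ℝ`. -/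
def leviForm {n : ℕ} (r : EuclideanSpace ℂ (Fin n) → ℝ) (p t : EuclideanSpace ℂ (Fin n)) : ℝ :=
  (∑ j, ∑ k, dz j (fun z => dzbar k (fun w => (r w : ℂ)) z) p * t j * conj (t k)).re

/-- `t` is a complex tangent vector at `p` to the level set of `r`: `∑ j, ∂r/∂z_j (p) t_j = 0`. -/
def IsComplexTangent {n : ℕ} (r : EuclideanSpace ℂ (Fin n) → ℝ)
    (p t : EuclideanSpace ℂ (Fin n)) : Prop :=
  ∑ j, dz j (fun w => (r w : ℂ)) p * t j = 0

end

/-- Plurisubharmonicity on `S` of a function that is `C²` near every point of `S`. -/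
def IsPlurisubharmonicOn {n : ℕ} (ρ : EuclideanSpace ℂ (Fin n) → ℝ)
    (S : Set (EuclideanSpace ℂ (Fin n))) : Prop :=
  (∀ p ∈ S, ContDiffAt ℝ 2 ρ p) ∧ ∀ p ∈ S, ∀ t, 0 ≤ leviForm ρ p t

/-- Strict plurisubharmonicity on `S` of a function that is `C²` near every point of `S`. -/
def IsStrictlyPlurisubharmonicOn {n : ℕ} (ρ : EuclideanSpace ℂ (Fin n) → ℝ)
    (S : Set (EuclideanSpace ℂ (Fin n))) : Prop :=
  (∀ p ∈ S, ContDiffAt ℝ 2 ρ p) ∧ ∀ p ∈ S, ∀ t, t ≠ 0 → 0 < leviForm ρ p t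

/-- The Hermitian part of a real bilinear form, up to a factor: `H(t, t) + H(it, it)`. -/
noncomputable def hermitianPart {n : ℕ}
    (H : EuclideanSpace ℂ (Fin n) →L[ℝ] EuclideanSpace ℂ (Fin n) →L[ℝ] ℝ)
    (t : EuclideanSpace ℂ (Fin n)) : ℝ :=
  H t t + H (Complex.I • t) (Complex.I • t)

/-- The squared modulus of the complex-linear extension of a real functional:
`ℓ(t)² + ℓ(it)²`. -/
noncomputable def complexSq {n : ℕ} (l : EuclideanSpace ℂ (Fin n) →L[ℝ] ℝ)
    (t : EuclideanSpace ℂ (Fin n)) : ℝ :=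
  l t ^ 2 + l (Complex.I • t) ^ 2

theorem sum_single_add_single {n : ℕ} (t : EuclideanSpace ℂ (Fin n)) :
    ∑ j, ((t j).re • EuclideanSpace.single j (1 : ℂ)
      + (t j).im • EuclideanSpace.single j Complex.I) = t := by
  ext k
  simp only [WithLp.ofLp_sum, Finset.sum_apply, PiLp.add_apply, PiLp.smul_apply,
    PiLp.single_apply, smul_ite, smul_zero, Finset.sum_add_distrib, Finset.sum_ite_eq, Finset.mem_univ,
    if_true, Complex.real_smul, mul_one]
  exact Complex.re_add_im (t k)

theorem sum_single_I_smul {n : ℕ} (t : EuclideanSpace ℂ (Fin n)) :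
    ∑ j, ((t j).re • EuclideanSpace.single j Complex.I
      - (t j).im • EuclideanSpace.single j (1 : ℂ)) = Complex.I • t := by
  conv_rhs => rw [← sum_single_add_single (Complex.I • t)]
  refine Finset.sum_congr rfl fun j _ => ?_
  simp only [PiLp.smul_apply, smul_eq_mul, Complex.mul_re, Complex.mul_im, Complex.I_re,
    Complex.I_im]
  module

theorem fderiv_ofReal_comp {n : ℕ} {r : EuclideanSpace ℂ (Fin n) → ℝ}
    {p : EuclideanSpace ℂ (Fin n)} (h : DifferentiableAt ℝ r p) (v : EuclideanSpace ℂ (Fin n)) :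
    fderiv ℝ (fun w => (r w : ℂ)) p v = (fderiv ℝ r p v : ℂ) := by
  have := (Complex.ofRealCLM.hasFDerivAt (x := r p)).comp p h.hasFDerivAt
  have h2 : HasFDerivAt (fun w => (r w : ℂ)) (Complex.ofRealCLM.comp (fderiv ℝ r p)) p := this
  rw [h2.fderiv]; rfl

theorem sum_dz_mul {n : ℕ} {r : EuclideanSpace ℂ (Fin n) → ℝ}
    {p : EuclideanSpace ℂ (Fin n)} (h : DifferentiableAt ℝ r p) (t : EuclideanSpace ℂ (Fin n)) :
    ∑ j, dz j (fun w => (r w : ℂ)) p * t j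
      = (fderiv ℝ r p t - Complex.I * fderiv ℝ r p (Complex.I • t)) / 2 := by
  conv_rhs => rw [← sum_single_I_smul t]
  conv_rhs =>
    enter [1, 1]
    rw [← sum_single_add_single t]
  simp only [map_sum, map_add, map_sub, map_smul, dz, fderiv_ofReal_comp h, smul_eq_mul]
  push_cast
  rw [Finset.mul_sum, ← Finset.sum_sub_distrib, Finset.sum_div]
  refine Finset.sum_congr rfl fun j _ => ?_
  nth_rewrite 1 [← Complex.re_add_im (t j)]
  linear_combination (-(1/2) * fderiv ℝ r p (EuclideanSpace.single j Complex.I) * (t j).im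
    : ℂ) * Complex.I_sq

theorem isComplexTangent_iff {n : ℕ} {r : EuclideanSpace ℂ (Fin n) → ℝ}
    {p t : EuclideanSpace ℂ (Fin n)} (h : DifferentiableAt ℝ r p) :
    IsComplexTangent r p t ↔ fderiv ℝ r p t = 0 ∧ fderiv ℝ r p (Complex.I • t) = 0 := by
  rw [IsComplexTangent, sum_dz_mul h, Complex.ext_iff]
  simp

theorem dz_dzbar {n : ℕ} {r : EuclideanSpace ℂ (Fin n) → ℝ}
    {p : EuclideanSpace ℂ (Fin n)} (h : ContDiffAt ℝ 2 r p) (j k : Fin n) :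
    dz j (fun z => dzbar k (fun w => (r w : ℂ)) z) p =
      (fderiv ℝ (fderiv ℝ r) p (EuclideanSpace.single j 1) (EuclideanSpace.single k 1)
      + Complex.I * fderiv ℝ (fderiv ℝ r) p (EuclideanSpace.single j 1)
          (EuclideanSpace.single k Complex.I)
      - Complex.I * (fderiv ℝ (fderiv ℝ r) p (EuclideanSpace.single j Complex.I)
          (EuclideanSpace.single k 1)
      + Complex.I * fderiv ℝ (fderiv ℝ r) p (EuclideanSpace.single j Complex.I)
          (EuclideanSpace.single k Complex.I))) / 4 := by
  have hD : DifferentiableAt ℝ (fderiv ℝ r) p :=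
    (h.fderiv_right (m := 1) (by norm_num)).differentiableAt (by norm_num)
  have hev : (fun z => dzbar k (fun w => (r w : ℂ)) z) =ᶠ[nhds p] fun z =>
      ((fderiv ℝ r z (EuclideanSpace.single k 1) : ℂ)
        + Complex.I * (fderiv ℝ r z (EuclideanSpace.single k Complex.I) : ℂ)) / 2 := by
    filter_upwards [h.eventually (by simp)] with z hz
    have hz' := hz.differentiableAt (by norm_num)
    simp only [dzbar, fderiv_ofReal_comp hz']
  have hv : ∀ v : EuclideanSpace ℂ (Fin n), HasFDerivAt (fun z => (fderiv ℝ r z v : ℂ))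
      (Complex.ofRealCLM.comp ((fderiv ℝ (fderiv ℝ r) p).flip v)) p := by
    intro v
    have h1 : HasFDerivAt (fun z => fderiv ℝ r z v) ((fderiv ℝ (fderiv ℝ r) p).flip v) p := by
      simpa using hD.hasFDerivAt.clm_apply (hasFDerivAt_const v p)
    exact (Complex.ofRealCLM.hasFDerivAt (x := fderiv ℝ r p v)).comp p h1
  have hd := ((hv (EuclideanSpace.single k 1)).add
    ((hv (EuclideanSpace.single k Complex.I)).const_mul Complex.I)).mul_const ((2 : ℂ)⁻¹)
  have hd' : HasFDerivAt (fun z => ((fderiv ℝ r z (EuclideanSpace.single k 1) : ℂ)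
        + Complex.I * (fderiv ℝ r z (EuclideanSpace.single k Complex.I) : ℂ)) / 2) _ p := hd
  rw [dz, hev.fderiv_eq, hd'.fderiv]
  simp
  ring

theorem leviForm_eq {n : ℕ} {r : EuclideanSpace ℂ (Fin n) → ℝ}
    {p : EuclideanSpace ℂ (Fin n)} (h : ContDiffAt ℝ 2 r p) (t : EuclideanSpace ℂ (Fin n)) :
    leviForm r p t = hermitianPart (fderiv ℝ (fderiv ℝ r) p) t / 4 := by
  rw [hermitianPart]
  conv_rhs => rw [← sum_single_I_smul t]
  conv_rhs =>
    enter [1, 1]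
    rw [← sum_single_add_single t]
  rw [leviForm]
  simp only [dz_dzbar h]
  simp only [map_sum, map_add, map_sub, map_smul, _root_.sum_apply,
    _root_.add_apply, _root_.sub_apply, _root_.smul_apply,
    smul_eq_mul, Complex.re_sum]
  rw [Finset.sum_comm, ← Finset.sum_add_distrib, Finset.sum_div]
  refine Finset.sum_congr rfl fun k _ => ?_
  rw [Finset.mul_sum, Finset.mul_sum, Finset.mul_sum, Finset.mul_sum,
    ← Finset.sum_add_distrib, ← Finset.sum_sub_distrib, ← Finset.sum_add_distrib, Finset.sum_div]
  refine Finset.sum_congr rfl fun j _ => ?_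
  generalize fderiv ℝ (fderiv ℝ r) p = H
  simp
  ring

set_option maxHeartbeats 1000000 in
theorem exists_hermitianPart_add_complexSq_ge {n : ℕ} {M c κ : ℝ} (hM : 0 < M) (hc : 0 < c)
    (hκ : 0 < κ) : ∃ K > 0, ∀ (l : EuclideanSpace ℂ (Fin n) →L[ℝ] ℝ)
      (H : EuclideanSpace ℂ (Fin n) →L[ℝ] EuclideanSpace ℂ (Fin n) →L[ℝ] ℝ),
      c ≤ ‖l‖ → ‖H‖ ≤ M →
      (∀ t, l t = 0 → l (Complex.I • t) = 0 → 4 * κ * ‖t‖ ^ 2 ≤ hermitianPart H t) →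
      ∀ t, κ * ‖t‖ ^ 2 ≤ hermitianPart H t + K * complexSq l t := by
  refine ⟨4 * (2 * M ^ 2 / κ + 2 * M + 2 * κ) / c ^ 2, by positivity, ?_⟩
  intro l H hl hH hT t
  obtain ⟨e, he, hle⟩ := l.exists_lt_apply_of_lt_opNorm (show c / 2 < ‖l‖ by linarith)
  set φ := StrongDual.extendRCLike (𝕜 := ℂ) l with hφ
  have hφa : ∀ v, φ v = (l v : ℂ) - Complex.I * (l (Complex.I • v) : ℂ) := fun v => rfl
  have hφn : ∀ v, ‖φ v‖ ^ 2 = complexSq l v := by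
    intro v
    rw [Complex.sq_norm, Complex.normSq_apply, hφa, complexSq]; simp; ring
  have hφe : c ^ 2 / 4 ≤ ‖φ e‖ ^ 2 := by
    rw [hφn, complexSq]
    have : (c / 2) ^ 2 ≤ ‖l e‖ ^ 2 := by gcongr
    rw [Real.norm_eq_abs, sq_abs] at this
    nlinarith [sq_nonneg (l (Complex.I • e))]
  have hφ0 : φ e ≠ 0 := by
    intro h; rw [h] at hφe; simp at hφe; nlinarith [pow_pos hc 2]
  set β := φ t / φ e with hβ
  have hβn : ‖β‖ ^ 2 ≤ 4 / c ^ 2 * complexSq l t := by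
    rw [hβ, norm_div, div_pow, hφn, div_mul_eq_mul_div, div_le_div_iff₀ (by nlinarith [pow_pos hc 2]) (by positivity)]
    have : 0 ≤ complexSq l t := by rw [complexSq]; positivity
    nlinarith
  set u := β • e with hu
  set s := t - u with hs
  have hts : t = s + u := by simp [hs]
  have hun : ‖u‖ ≤ ‖β‖ := by
    rw [hu, norm_smul]; exact mul_le_of_le_one_right (norm_nonneg _) he.le
  have hφs : φ s = 0 := by
    rw [hs, map_sub, hu, map_smul, hβ, smul_eq_mul, div_mul_cancel₀ _ hφ0, sub_self]
  have hs0 : l s = 0 ∧ l (Complex.I • s) = 0 := by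
    have := hφn s
    rw [hφs, complexSq] at this
    simp at this
    constructor <;> nlinarith [sq_nonneg (l s), sq_nonneg (l (Complex.I • s))]
  have hS := hT s hs0.1 hs0.2
  have hB : ∀ v w, |H v w| ≤ M * ‖v‖ * ‖w‖ := fun v w => by
    rw [← Real.norm_eq_abs]
    exact (H.le_opNorm₂ v w).trans (by gcongr)
  have hnI : ∀ v : EuclideanSpace ℂ (Fin n), ‖Complex.I • v‖ = ‖v‖ := fun v => by
    rw [norm_smul, Complex.norm_I, one_mul]
  have hexp : hermitianPart H t = hermitianPart H s + (H s u + H u s + H u u +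
      (H (Complex.I • s) (Complex.I • u) + H (Complex.I • u) (Complex.I • s)
        + H (Complex.I • u) (Complex.I • u))) := by
    rw [hts, hermitianPart, hermitianPart]
    simp only [smul_add, map_add, _root_.add_apply]
    ring
  have b1 := abs_le.1 (hB s u)
  have b2 := abs_le.1 (hB u s)
  have b3 := abs_le.1 (hB u u)
  have b4 := abs_le.1 (hB (Complex.I • s) (Complex.I • u))
  have b5 := abs_le.1 (hB (Complex.I • u) (Complex.I • s))
  have b6 := abs_le.1 (hB (Complex.I • u) (Complex.I • u))
  simp only [hnI] at b4 b5 b6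
  have hlow : 4 * κ * ‖s‖ ^ 2 - 4 * (M * ‖s‖ * ‖u‖) - 2 * (M * ‖u‖ * ‖u‖)
      ≤ hermitianPart H t := by
    rw [hexp]; linarith [b1.1, b2.1, b3.1, b4.1, b5.1, b6.1, mul_right_comm M ‖s‖ ‖u‖]
  have htn : ‖t‖ ^ 2 ≤ 2 * ‖s‖ ^ 2 + 2 * ‖u‖ ^ 2 := by
    have : ‖t‖ ≤ ‖s‖ + ‖u‖ := by rw [hts]; exact norm_add_le _ _
    have h2 : ‖t‖ ^ 2 ≤ (‖s‖ + ‖u‖) ^ 2 := by gcongr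
    nlinarith [sq_nonneg (‖s‖ - ‖u‖)]
  have hsq : 0 ≤ 2 * κ * ‖s‖ ^ 2 - 4 * (M * ‖s‖ * ‖u‖) + 2 * M ^ 2 / κ * ‖u‖ ^ 2 := by
    have : 2 * κ * ‖s‖ ^ 2 - 4 * (M * ‖s‖ * ‖u‖) + 2 * M ^ 2 / κ * ‖u‖ ^ 2
      = 2 / κ * (κ * ‖s‖ - M * ‖u‖) ^ 2 := by field_simp; ring
    rw [this]; positivity
  have hfin : (2 * M ^ 2 / κ + 2 * M + 2 * κ) * ‖u‖ ^ 2 ≤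
      4 * (2 * M ^ 2 / κ + 2 * M + 2 * κ) / c ^ 2 * complexSq l t := by
    calc _ ≤ (2 * M ^ 2 / κ + 2 * M + 2 * κ) * (4 / c ^ 2 * complexSq l t) := by
          gcongr
          exact le_trans (by gcongr) hβn
      _ = _ := by ring
  nlinarith [mul_le_mul_of_nonneg_left htn hκ.le]

section Real

variable {E : Type*} [NormedAddCommGroup E] [NormedSpace ℝ E]

theorem fderiv_nonpos_of_sign {f g : E → ℝ} {p w : E} (hf : DifferentiableAt ℝ f p)
    (hg : DifferentiableAt ℝ g p) (hfp : f p = 0) (hgp : g p = 0)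
    (h : ∀ᶠ z in nhds p, f z < 0 → g z < 0) (hw : fderiv ℝ f p w < 0) :
    fderiv ℝ g p w ≤ 0 := by
  by_contra! hgw
  have hline : HasDerivAt (fun s : ℝ => p + s • w) w 0 := by
    simpa using ((hasDerivAt_id (0 : ℝ)).smul_const w).const_add p
  have hp0 : p + (0 : ℝ) • w = p := by simp
  have hF : HasDerivAt (fun s : ℝ => f (p + s • w)) (fderiv ℝ f p w) 0 :=
    HasFDerivAt.comp_hasDerivAt (l := f) 0 (by rw [hp0]; exact hf.hasFDerivAt) hline
  have hG : HasDerivAt (fun s : ℝ => g (p + s • w)) (fderiv ℝ g p w) 0 :=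
    HasFDerivAt.comp_hasDerivAt (l := g) 0 (by rw [hp0]; exact hg.hasFDerivAt) hline
  have hlim : Filter.Tendsto (fun s : ℝ => p + s • w) (nhdsWithin 0 (Set.Ioi 0)) (nhds p) := by
    have := hline.continuousAt.tendsto
    rw [hp0] at this
    exact this.mono_left nhdsWithin_le_nhds
  have e1 := eventually_nhdsWithin_sign_eq_of_deriv_neg (f := fun s : ℝ => f (p + s • w))
    (x₀ := 0) (by rw [hF.deriv]; exact hw) (by simp [hfp])
  have e2 := eventually_nhdsWithin_sign_eq_of_deriv_pos (f := fun s : ℝ => g (p + s • w))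
    (x₀ := 0) (by rw [hG.deriv]; exact hgw) (by simp [hgp])
  have e1' := e1.filter_mono (nhdsWithin_le_nhds (s := Set.Ioi 0))
  have e2' := e2.filter_mono (nhdsWithin_le_nhds (s := Set.Ioi 0))
  obtain ⟨s, h1, h2, h3, hs⟩ :=
    (e1'.and (e2'.and ((hlim.eventually h).and self_mem_nhdsWithin))).exists
  have hs' : 0 < s := hs
  rw [sign_neg (by linarith : (0 : ℝ) - s < 0), sign_eq_neg_one_iff] at h1
  rw [sign_pos (by linarith : (0 : ℝ) < s - 0), sign_eq_one_iff] at h2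
  exact absurd (h3 h1) (not_lt.2 h2.le)

theorem exists_pos_smul_eq_of_neg_imp_nonpos {l m : E →L[ℝ] ℝ} (hl : l ≠ 0) (hm : m ≠ 0)
    (h : ∀ w, l w < 0 → m w ≤ 0) : ∃ a : ℝ, 0 < a ∧ m = a • l := by
  obtain ⟨w₀, hw₀⟩ : ∃ w, l w = -1 := by
    obtain ⟨v, hv⟩ : ∃ v, l v ≠ 0 := by
      by_contra! hh; exact hl (ContinuousLinearMap.ext hh)
    exact ⟨(-(l v)⁻¹) • v, by simp [hv]⟩
  have hker : ∀ w, l w = 0 → m w ≤ 0 := by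
    intro w hw
    by_contra! hpos
    have hb := h w₀ (by linarith)
    by_cases hz : m w₀ = 0
    · have := h (w + w₀) (by simp [hw, hw₀])
      rw [map_add, hz] at this; linarith
    · have hlt : m w₀ < 0 := lt_of_le_of_ne hb hz
      have := h (w + (m w / (-2 * m w₀)) • w₀) (by
        rw [map_add, map_smul, hw, hw₀, smul_eq_mul]
        have : 0 < m w / (-2 * m w₀) := div_pos hpos (by linarith)
        linarith)
      rw [map_add, map_smul, smul_eq_mul, div_mul_eq_mul_div,
        mul_div_mul_right _ _ hz] at this
      linarith
  have hker' : ∀ w, l w = 0 → m w = 0 := fun w hw => le_antisymm (hker w hw) (by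
    have := hker (-w) (by simp [hw])
    rw [map_neg] at this; linarith)
  have heq : m = (-(m w₀)) • l := by
    ext w
    have := hker' (w + l w • w₀) (by simp [hw₀])
    simp at this ⊢
    linarith
  refine ⟨-(m w₀), ?_, heq⟩
  have hb := h w₀ (by linarith)
  rcases hb.lt_or_eq with h1 | h1
  · linarith
  · exfalso; apply hm; rw [heq, h1]; simp

/-- The first and second derivatives of `f` along the curve `s ↦ p + s v + s² w`. -/
theorem deriv_comp_parabola {f : E → ℝ} {p : E} (hf : ContDiffAt ℝ 2 f p) (v w : E) :
    ContinuousAt (fun s : ℝ => f (p + s • v + s ^ 2 • w)) 0 ∧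
    deriv (fun s : ℝ => f (p + s • v + s ^ 2 • w)) 0 = fderiv ℝ f p v ∧
    deriv (deriv fun s : ℝ => f (p + s • v + s ^ 2 • w)) 0
      = fderiv ℝ (fderiv ℝ f) p v v + 2 * fderiv ℝ f p w := by
  have hγ : ∀ s : ℝ, HasDerivAt (fun s : ℝ => p + s • v + s ^ 2 • w) (v + (2 * s) • w) s := by
    intro s
    have : HasDerivAt (fun s : ℝ => p + s • v + s ^ 2 • w) _ s :=
      (((hasDerivAt_id s).smul_const v).const_add p).add ((hasDerivAt_pow 2 s).smul_const w)
    simpa using this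
  have hγ0 : p + (0 : ℝ) • v + (0 : ℝ) ^ 2 • w = p := by simp
  have hlim : Filter.Tendsto (fun s : ℝ => p + s • v + s ^ 2 • w) (nhds 0) (nhds p) := by
    have := (hγ 0).continuousAt.tendsto
    rwa [hγ0] at this
  have hD : DifferentiableAt ℝ (fderiv ℝ f) p :=
    (hf.fderiv_right (m := 1) (by norm_num)).differentiableAt (by norm_num)
  have hev : ∀ᶠ s : ℝ in nhds 0, HasDerivAt (fun s : ℝ => f (p + s • v + s ^ 2 • w))
      (fderiv ℝ f (p + s • v + s ^ 2 • w) (v + (2 * s) • w)) s := by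
    filter_upwards [hlim.eventually (hf.eventually (by simp))] with s hs
    exact HasFDerivAt.comp_hasDerivAt (l := f) s
      (hs.differentiableAt (by norm_num)).hasFDerivAt (hγ s)
  have h1 := hev.self_of_nhds
  refine ⟨h1.continuousAt, ?_, ?_⟩
  · rw [h1.deriv]; simp
  · have heq : (deriv fun s : ℝ => f (p + s • v + s ^ 2 • w)) =ᶠ[nhds 0]
        fun s => fderiv ℝ f (p + s • v + s ^ 2 • w) (v + (2 * s) • w) := by
      filter_upwards [hev] with s hs using hs.deriv
    rw [heq.deriv_eq]
    have h2 : HasDerivAt (fun s : ℝ => fderiv ℝ f (p + s • v + s ^ 2 • w))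
        (fderiv ℝ (fderiv ℝ f) p (v + (2 * 0 : ℝ) • w)) 0 :=
      HasFDerivAt.comp_hasDerivAt (l := fderiv ℝ f) 0
        (by rw [hγ0]; exact hD.hasFDerivAt) (hγ 0)
    have h3 : HasDerivAt (fun s : ℝ => v + (2 * s) • w) ((2 : ℝ) • w) 0 := by
      simpa using (((hasDerivAt_id (0 : ℝ)).const_mul 2).smul_const w).const_add v
    rw [(h2.clm_apply h3).deriv]
    simp

theorem mul_hessian_le_of_sign {f g : E → ℝ} {p v : E} {a : ℝ} (hf : ContDiffAt ℝ 2 f p)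
    (hg : ContDiffAt ℝ 2 g p) (hfp : f p = 0) (hgp : g p = 0)
    (h : ∀ᶠ z in nhds p, g z < 0 → f z < 0) (ha : 0 < a)
    (hfg : fderiv ℝ g p = a • fderiv ℝ f p) (hne : fderiv ℝ f p ≠ 0)
    (hv : fderiv ℝ f p v = 0) :
    a * fderiv ℝ (fderiv ℝ f) p v v ≤ fderiv ℝ (fderiv ℝ g) p v v := by
  by_contra! hlt
  set A := fderiv ℝ (fderiv ℝ f) p v v
  set B := fderiv ℝ (fderiv ℝ g) p v v
  obtain ⟨w, hw⟩ : ∃ w, fderiv ℝ f p w = -(A + B / a) / 4 := by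
    obtain ⟨u, hu⟩ : ∃ u, fderiv ℝ f p u ≠ 0 := by
      by_contra! hh; exact hne (ContinuousLinearMap.ext hh)
    exact ⟨(-(A + B / a) / 4 / fderiv ℝ f p u) • u, by
      rw [map_smul, smul_eq_mul, div_mul_cancel₀ _ hu]⟩
  have hBa : B / a < A := by rw [div_lt_iff₀ ha]; linarith
  obtain ⟨fc, fd, fdd⟩ := deriv_comp_parabola hf v w
  obtain ⟨gc, gd, gdd⟩ := deriv_comp_parabola hg v w
  have hgv : fderiv ℝ g p v = 0 := by rw [hfg]; simp [hv]
  have hmin := isLocalMin_of_deriv_deriv_pos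
    (by rw [fdd, hw]; change 0 < A + _; linarith) (by rw [fd, hv]) fc
  set η := -(B + 2 * (a * (-(A + B / a) / 4))) / 4 with hη
  have hηpos : 0 < η := by
    have : a * (B / a) = B := by field_simp
    nlinarith
  have hder : ∀ s : ℝ, HasDerivAt (fun s : ℝ => η * s ^ 2) (2 * η * s) s := fun s => by
    have h2 : HasDerivAt (fun s : ℝ => η * s ^ 2) _ s := (hasDerivAt_pow 2 s).const_mul η
    convert h2 using 1
    simp; ring
  have hgd : ∀ᶠ s : ℝ in nhds 0,
      DifferentiableAt ℝ (fun s : ℝ => g (p + s • v + s ^ 2 • w)) s := by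
    have hlim : Filter.Tendsto (fun s : ℝ => p + s • v + s ^ 2 • w) (nhds 0) (nhds p) := by
      have : Continuous fun s : ℝ => p + s • v + s ^ 2 • w := by fun_prop
      simpa using this.tendsto 0
    filter_upwards [hlim.eventually (hg.eventually (by simp))] with s hs
    exact DifferentiableAt.comp (g := g) s (hs.differentiableAt (by norm_num)) (by fun_prop)
  have hde : deriv (fun s : ℝ => g (p + s • v + s ^ 2 • w) + η * s ^ 2) =ᶠ[nhds 0]
      fun s => deriv (fun s : ℝ => g (p + s • v + s ^ 2 • w)) s + 2 * η * s := by
    filter_upwards [hgd] with s hs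
    rw [← (hder s).deriv]
    exact deriv_add hs (hder s).differentiableAt
  have hgdd : deriv (deriv fun s : ℝ => g (p + s • v + s ^ 2 • w)) 0 = - 4 * η := by
    rw [gdd, hfg, hη]
    simp [hw]
    ring
  have hdd : deriv (deriv fun s : ℝ => g (p + s • v + s ^ 2 • w) + η * s ^ 2) 0 = - 2 * η := by
    rw [hde.deriv_eq]
    have d1 : HasDerivAt (deriv fun s : ℝ => g (p + s • v + s ^ 2 • w)) (-4 * η) 0 := by
      rw [← hgdd]
      refine DifferentiableAt.hasDerivAt (differentiableAt_of_deriv_ne_zero ?_)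
      rw [hgdd]; nlinarith
    have d2 : HasDerivAt (fun s : ℝ => 2 * η * s) (2 * η) 0 := by
      have : HasDerivAt (fun s : ℝ => 2 * η * s) _ 0 := (hasDerivAt_id (0 : ℝ)).const_mul (2 * η)
      simpa using this
    have d3 : HasDerivAt (fun s : ℝ => deriv (fun s : ℝ => g (p + s • v + s ^ 2 • w)) s
      + 2 * η * s) (-4 * η + 2 * η) 0 := d1.add d2
    rw [d3.deriv]
    ring
  have hmax := isLocalMax_of_deriv_deriv_neg
    (f := fun s : ℝ => g (p + s • v + s ^ 2 • w) + η * s ^ 2) (x₀ := 0)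
    (by rw [hdd]; linarith) (by rw [hde.eq_of_nhds, gd, hgv]; simp)
    (gc.add (hder 0).continuousAt)
  have hlim : Filter.Tendsto (fun s : ℝ => p + s • v + s ^ 2 • w) (nhds 0) (nhds p) := by
    have : Continuous fun s : ℝ => p + s • v + s ^ 2 • w := by fun_prop
    simpa using this.tendsto 0
  have hall := ((hmin : ∀ᶠ s in nhds _, _).and
    ((hmax : ∀ᶠ s in nhds _, _).and (hlim.eventually h))).filter_mono
      (nhdsWithin_le_nhds (s := Set.Ioi (0 : ℝ)))
  obtain ⟨s, ⟨h1, h2, h3⟩, hs⟩ := (hall.and self_mem_nhdsWithin).exists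
  have hs' : 0 < s := hs
  simp only [zero_smul, add_zero, ne_eq, OfNat.ofNat_ne_zero, not_false_eq_true, zero_pow,
    hfp, hgp, mul_zero] at h1 h2
  have : 0 < η * s ^ 2 := by positivity
  linarith [h3 (by linarith)]

end Real

namespace IsDefiningFunction

variable {E : Type*} [NormedAddCommGroup E] [NormedSpace ℝ E] {m : ℕ} {Ω U : Set E} {ρ : E → ℝ}

theorem lt_zero_iff (h : IsDefiningFunction m Ω U ρ) {x : E} (hx : x ∈ U) : ρ x < 0 ↔ x ∈ Ω := by
  have := Set.ext_iff.1 h.neg_eq x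
  simpa [hx] using this

theorem contDiffAt (h : IsDefiningFunction m Ω U ρ) {x : E} (hx : x ∈ U) : ContDiffAt ℝ m ρ x :=
  h.contDiffOn.contDiffAt (h.isOpen.mem_nhds hx)

theorem eq_zero (h : IsDefiningFunction m Ω U ρ) (hΩ : IsOpen Ω) {x : E} (hx : x ∈ frontier Ω) :
    ρ x = 0 := by
  have hxU := h.frontier_subset hx
  rw [hΩ.frontier_eq] at hx
  refine le_antisymm ?_ (not_lt.1 fun h' => hx.2 ((h.lt_zero_iff hxU).1 h'))
  by_contra! hpos
  have hc := (h.contDiffAt hxU).continuousAt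
  have hev := (hc.eventually (lt_mem_nhds hpos)).and (h.isOpen.mem_nhds hxU)
  obtain ⟨y, ⟨hy, hyU⟩, hyΩ⟩ := mem_closure_iff_nhds.1 hx.1 _ hev
  exact absurd ((h.lt_zero_iff hyU).2 hyΩ) (not_lt.2 (le_of_lt hy))

end IsDefiningFunction

theorem hermitianPart_ge_of_leviForm_ge {n : ℕ} {Ω U₀ V : Set (EuclideanSpace ℂ (Fin n))}
    (hΩ : IsOpen Ω) {r ρ : EuclideanSpace ℂ (Fin n) → ℝ} (hr : IsDefiningFunction 2 Ω U₀ r)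
    (hρ : IsDefiningFunction 2 Ω V ρ) {C : ℝ} {p : EuclideanSpace ℂ (Fin n)}
    (hp : p ∈ frontier Ω)
    (hLevi : ∀ t : EuclideanSpace ℂ (Fin n), IsComplexTangent r p t →
      C * ‖fderiv ℝ r p‖ * ∑ j, ‖t j‖ ^ 2 ≤ leviForm r p t)
    (t : EuclideanSpace ℂ (Fin n)) (ht : fderiv ℝ ρ p t = 0)
    (ht' : fderiv ℝ ρ p (Complex.I • t) = 0) :
    4 * (C * ‖fderiv ℝ ρ p‖) * ‖t‖ ^ 2 ≤ hermitianPart (fderiv ℝ (fderiv ℝ ρ) p) t := by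
  have hr2 : ContDiffAt ℝ 2 r p := hr.contDiffAt (hr.frontier_subset hp)
  have hρ2 : ContDiffAt ℝ 2 ρ p := hρ.contDiffAt (hρ.frontier_subset hp)
  have hnhds : ∀ᶠ z in nhds p, (r z < 0 ↔ ρ z < 0) := by
    filter_upwards [hr.isOpen.mem_nhds (hr.frontier_subset hp),
      hρ.isOpen.mem_nhds (hρ.frontier_subset hp)] with z h1 h2
    rw [hr.lt_zero_iff h1, hρ.lt_zero_iff h2]
  obtain ⟨a, ha, hD⟩ := exists_pos_smul_eq_of_neg_imp_nonpos (hr.fderiv_ne_zero p hp)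
    (hρ.fderiv_ne_zero p hp) fun w hw => fderiv_nonpos_of_sign
      (hr2.differentiableAt (by norm_num)) (hρ2.differentiableAt (by norm_num))
      (hr.eq_zero hΩ hp) (hρ.eq_zero hΩ hp) (hnhds.mono fun z hz => hz.1) hw
  have htan : ∀ v, fderiv ℝ ρ p v = 0 → fderiv ℝ r p v = 0 := by
    intro v hv
    rw [hD] at hv
    simpa [ha.ne'] using hv
  have hH : ∀ v, fderiv ℝ ρ p v = 0 →
      a * fderiv ℝ (fderiv ℝ r) p v v ≤ fderiv ℝ (fderiv ℝ ρ) p v v := fun v hv =>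
    mul_hessian_le_of_sign hr2 hρ2 (hr.eq_zero hΩ hp) (hρ.eq_zero hΩ hp)
      (hnhds.mono fun z hz => hz.2) ha hD (hr.fderiv_ne_zero p hp) (htan v hv)
  have hL := hLevi t ((isComplexTangent_iff (hr2.differentiableAt (by norm_num))).2
    ⟨htan _ ht, htan _ ht'⟩)
  rw [leviForm_eq hr2, ← EuclideanSpace.norm_sq_eq, hermitianPart] at hL
  rw [hermitianPart, hD, norm_smul, Real.norm_of_nonneg ha.le]
  nlinarith [hH t ht, hH _ ht', mul_le_mul_of_nonneg_left hL ha.le]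

theorem hasDerivAt_max_zero_pow (k : ℕ) (x : ℝ) :
    HasDerivAt (fun x : ℝ => max x 0 ^ (k + 2)) ((k + 2) * max x 0 ^ (k + 1)) x := by
  have hpow : HasDerivAt (fun x : ℝ => x ^ (k + 2)) ((k + 2) * x ^ (k + 1)) x := by
    simpa using hasDerivAt_pow (k + 2) x
  rcases lt_trichotomy x 0 with hx | rfl | hx
  · rw [max_eq_right hx.le]
    refine HasDerivAt.congr_of_eventuallyEq (f := fun _ => (0 : ℝ))
      (by simpa using hasDerivAt_const x (0 : ℝ)) ?_
    filter_upwards [gt_mem_nhds hx] with y hy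
    simp [max_eq_right hy.le]
  · rw [← hasDerivWithinAt_univ, ← Set.Iic_union_Ici (a := (0 : ℝ))]
    refine HasDerivWithinAt.union ?_ ?_
    · refine HasDerivWithinAt.congr (f := fun _ => (0 : ℝ))
        (by simpa using hasDerivWithinAt_const (0 : ℝ) (Set.Iic 0) (0 : ℝ)) ?_ (by simp)
      intro y hy
      simp [max_eq_right (Set.mem_Iic.1 hy)]
    · refine HasDerivWithinAt.congr (f := fun x : ℝ => x ^ (k + 2))
        (by simpa using hpow.hasDerivWithinAt) ?_ (by simp)
      intro y hy
      simp [max_eq_left (Set.mem_Ici.1 hy)]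
  · rw [max_eq_left hx.le]
    refine hpow.congr_of_eventuallyEq ?_
    filter_upwards [lt_mem_nhds hx] with y hy
    simp [max_eq_left (le_of_lt hy)]

theorem contDiff_max_zero_pow (k : ℕ) : ContDiff ℝ k (fun x : ℝ => max x 0 ^ (k + 1)) := by
  induction k with
  | zero => exact contDiff_zero.2 (by fun_prop)
  | succ k ih =>
    have hd : deriv (fun x : ℝ => max x 0 ^ (k + 2)) = fun x : ℝ => ((k : ℝ) + 2) * max x 0 ^ (k + 1) :=
      funext fun x => (hasDerivAt_max_zero_pow k x).deriv
    have := contDiff_succ_iff_deriv (𝕜 := ℝ) (n := k) (f := fun x : ℝ => max x 0 ^ (k + 2))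
    push_cast
    refine this.2 ⟨fun x => (hasDerivAt_max_zero_pow k x).differentiableAt, by simp, ?_⟩
    rw [hd]
    exact contDiff_const.mul ih

/-- The convex `C³` function `x ↦ max(x + a, 0)⁴ - a⁴`. -/
noncomputable def quarticCutoff (a x : ℝ) : ℝ := max (x + a) 0 ^ 4 - a ^ 4

theorem contDiff_quarticCutoff (a : ℝ) : ContDiff ℝ 3 (quarticCutoff a) :=
  ((contDiff_max_zero_pow 3).comp (contDiff_id.add contDiff_const)).sub contDiff_const

theorem hasDerivAt_quarticCutoff (a x : ℝ) :
    HasDerivAt (quarticCutoff a) (4 * max (x + a) 0 ^ 3) x := by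
  have h : HasDerivAt (fun y : ℝ => max (y + a) 0 ^ 4) _ x :=
    (hasDerivAt_max_zero_pow 2 (x + a)).comp_add_const x a
  have h2 := h.sub_const (a ^ 4)
  norm_num only [Nat.cast_ofNat] at h2
  exact h2

theorem hasDerivAt_deriv_quarticCutoff (a x : ℝ) :
    HasDerivAt (fun x => 4 * max (x + a) 0 ^ 3) (12 * max (x + a) 0 ^ 2) x := by
  have h : HasDerivAt (fun y : ℝ => max (y + a) 0 ^ 3) _ x :=
    (hasDerivAt_max_zero_pow 1 (x + a)).comp_add_const x a
  have h2 : HasDerivAt (fun x : ℝ => 4 * max (x + a) 0 ^ 3) _ x := h.const_mul 4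
  norm_num [← mul_assoc] at h2
  exact h2

theorem quarticCutoff_neg_iff {a : ℝ} (ha : 0 < a) (x : ℝ) : quarticCutoff a x < 0 ↔ x < 0 := by
  rw [quarticCutoff, sub_neg, pow_lt_pow_iff_left₀ (le_max_right _ _) ha.le (by norm_num),
    max_lt_iff]
  constructor
  · intro h; linarith [h.1]
  · intro h; exact ⟨by linarith, ha⟩

theorem quarticCutoff_of_le {a x : ℝ} (h : x ≤ -a) : quarticCutoff a x = -a ^ 4 := by
  rw [quarticCutoff, max_eq_right (by linarith)]; simp

section Comp

variable {n : ℕ} {ρ : EuclideanSpace ℂ (Fin n) → ℝ} {p : EuclideanSpace ℂ (Fin n)}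

theorem fderiv_comp_eq_smul {φ φ' : ℝ → ℝ} (hφ : ∀ x, HasDerivAt φ (φ' x) x)
    (hρ : DifferentiableAt ℝ ρ p) :
    fderiv ℝ (fun z => φ (ρ z)) p = φ' (ρ p) • fderiv ℝ ρ p :=
  ((hφ (ρ p)).comp_hasFDerivAt p hρ.hasFDerivAt).fderiv

theorem leviForm_comp {φ φ' φ'' : ℝ → ℝ} (hφ : ∀ x, HasDerivAt φ (φ' x) x)
    (hφ' : ∀ x, HasDerivAt φ' (φ'' x) x) (hc : ContDiff ℝ 2 φ) (hρ : ContDiffAt ℝ 2 ρ p)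
    (t : EuclideanSpace ℂ (Fin n)) :
    leviForm (fun z => φ (ρ z)) p t = (φ' (ρ p) * hermitianPart (fderiv ℝ (fderiv ℝ ρ) p) t
      + φ'' (ρ p) * complexSq (fderiv ℝ ρ p) t) / 4 := by
  have h2 : ContDiffAt ℝ 2 (fun z => φ (ρ z)) p := hc.contDiffAt.comp p hρ
  rw [leviForm_eq h2]
  have hev : fderiv ℝ (fun z => φ (ρ z)) =ᶠ[nhds p] fun z => φ' (ρ z) • fderiv ℝ ρ z := by
    filter_upwards [hρ.eventually (by simp)] with z hz
    exact fderiv_comp_eq_smul hφ (hz.differentiableAt (by norm_num))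
  have hD : DifferentiableAt ℝ (fderiv ℝ ρ) p :=
    (hρ.fderiv_right (m := 1) (by norm_num)).differentiableAt (by norm_num)
  have h1 : HasFDerivAt (fun z => φ' (ρ z)) (φ'' (ρ p) • fderiv ℝ ρ p) p :=
    (hφ' (ρ p)).comp_hasFDerivAt p (hρ.differentiableAt (by norm_num)).hasFDerivAt
  have h3 : HasFDerivAt (fun z => φ' (ρ z) • fderiv ℝ ρ z) _ p := h1.smul hD.hasFDerivAt
  rw [hev.fderiv_eq, h3.fderiv]
  simp [hermitianPart, complexSq]
  ring

theorem le_leviForm_quarticCutoff_comp {a K κ : ℝ} (hρ : ContDiffAt ℝ 2 ρ p)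
    {t : EuclideanSpace ℂ (Fin n)} (hK : K * max (ρ p + a) 0 ≤ 3)
    (h : κ * ‖t‖ ^ 2 ≤ hermitianPart (fderiv ℝ (fderiv ℝ ρ) p) t
      + K * complexSq (fderiv ℝ ρ p) t) :
    max (ρ p + a) 0 ^ 3 * (κ * ‖t‖ ^ 2) ≤ leviForm (fun z => quarticCutoff a (ρ z)) p t := by
  rw [leviForm_comp (hasDerivAt_quarticCutoff a) (hasDerivAt_deriv_quarticCutoff a)
    ((contDiff_quarticCutoff a).of_le (by norm_num)) hρ]
  have hs : 0 ≤ max (ρ p + a) 0 := le_max_right _ _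
  have hq : 0 ≤ complexSq (fderiv ℝ ρ p) t := by rw [complexSq]; positivity
  generalize max (ρ p + a) 0 = s at *
  have h1 := mul_le_mul_of_nonneg_left h (pow_nonneg hs 3)
  have h2 := mul_le_mul_of_nonneg_right hK (mul_nonneg (pow_nonneg hs 2) hq)
  nlinarith

end Comp

section Geometry

variable {E : Type*} [NormedAddCommGroup E] [NormedSpace ℝ E]

theorem ball_subset_of_disjoint_frontier {S : Set E} (hS : IsOpen S) {x : E} (hx : x ∈ S) {d : ℝ}
    (h : ∀ y ∈ frontier S, d ≤ dist y x) : Metric.ball x d ⊆ S := by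
  rcases le_or_gt d 0 with hd | hd
  · simp [Metric.ball_eq_empty.2 hd]
  · refine (convex_ball x d).isPreconnected.subset_left_of_subset_union hS
      isClosed_closure.isOpen_compl (disjoint_compl_right.mono_left subset_closure) ?_
      ⟨x, Metric.mem_ball_self hd, hx⟩
    intro y hy
    by_cases hyS : y ∈ S
    · exact Or.inl hyS
    · refine Or.inr fun hyc => ?_
      have := h y (by rw [hS.frontier_eq]; exact ⟨hyc, hyS⟩)
      exact absurd (Metric.mem_ball.1 hy) (not_lt.2 this)

variable {m : ℕ} {Ω V : Set E} {ρ : E → ℝ}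

theorem IsDefiningFunction.of_le {k : ℕ} (hk : k ≤ m) (h : IsDefiningFunction m Ω V ρ) :
    IsDefiningFunction k Ω V ρ :=
  { h with contDiffOn := h.contDiffOn.of_le (by exact_mod_cast hk) }

theorem IsUniformDefiningFunction.exists_ball_subset (h : IsUniformDefiningFunction m Ω V ρ) :
    ∃ η > 0, ∀ p ∈ frontier Ω, Metric.ball p η ⊆ V := by
  obtain ⟨η, hη, hd⟩ := h.dist_pos
  refine ⟨η, hη, fun p hp => ball_subset_of_disjoint_frontier h.isOpen (h.frontier_subset hp) ?_⟩
  intro y hy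
  rw [dist_comm]
  exact hd p hp y hy

theorem norm_fderiv_fderiv {F : Type*} [NormedAddCommGroup F] [NormedSpace ℝ F] (f : E → F) (x : E) :
    ‖fderiv ℝ (fderiv ℝ f) x‖ = ‖iteratedFDeriv ℝ 2 f x‖ := by
  rw [← norm_iteratedFDeriv_fderiv, norm_iteratedFDeriv_one]

set_option maxSynthPendingDepth 3 in
theorem norm_fderiv_fderiv_fderiv (f : E → ℝ) (x : E) :
    ‖fderiv ℝ (fderiv ℝ (fderiv ℝ f)) x‖ = ‖iteratedFDeriv ℝ 3 f x‖ := by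
  rw [norm_fderiv_fderiv (fderiv ℝ f), norm_iteratedFDeriv_fderiv]

theorem IsUniformDefiningFunction.exists_bound (h : IsUniformDefiningFunction m Ω V ρ) :
    ∃ M > 0, ∀ k ≤ m, ∀ x ∈ V, ‖iteratedFDeriv ℝ k ρ x‖ ≤ M := by
  obtain ⟨M, hM⟩ := h.bounded
  exact ⟨max M 1, by positivity, fun k hk x hx => (hM k hk x hx).trans (le_max_left _ _)⟩

/-- A function that is negative on `ball z d`, with gradient at least `c` at `z` and second
derivative at most `M`, is at most a definite negative constant at `z`. -/
theorem le_of_forall_ball_neg {f : E → ℝ} {z : E} {d s c M : ℝ} (hc : 0 < c) (hM : 0 < M)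
    (hs : 0 < s) (hsd : s ≤ d) (hsM : s ≤ c / (4 * M))
    (hf : ∀ y ∈ Metric.ball z d, ContDiffAt ℝ 2 f y)
    (hneg : ∀ y ∈ Metric.ball z d, f y < 0)
    (hgrad : c ≤ ‖fderiv ℝ f z‖)
    (hhess : ∀ y ∈ Metric.ball z d, ‖fderiv ℝ (fderiv ℝ f) y‖ ≤ M) : f z ≤ -(s * c / 4) := by
  obtain ⟨u, hu, hle⟩ :=
    (fderiv ℝ f z).exists_lt_apply_of_lt_opNorm (show c / 2 < ‖fderiv ℝ f z‖ by linarith)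
  obtain ⟨v, hv, hlv⟩ : ∃ v : E, ‖v‖ < 1 ∧ c / 2 < fderiv ℝ f z v := by
    rcases lt_abs.1 hle with h | h
    · exact ⟨u, hu, h⟩
    · exact ⟨-u, by simpa using hu, by simpa using h⟩
  have hd : 0 < d := hs.trans_le hsd
  have hsub : Metric.ball z s ⊆ Metric.ball z d := Metric.ball_subset_ball hsd
  have hzs : z ∈ Metric.ball z s := Metric.mem_ball_self hs
  have hnorm : ‖s • v‖ < s := by
    rw [norm_smul, Real.norm_of_nonneg hs.le]
    nlinarith
  have hmem : z + s • v ∈ Metric.ball z s := by simpa using hnorm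
  have hlip : ∀ y ∈ Metric.ball z s, ‖fderiv ℝ f y - fderiv ℝ f z‖ ≤ M * s := by
    intro y hy
    refine (Convex.norm_image_sub_le_of_norm_fderiv_le (𝕜 := ℝ) (s := Metric.ball z s) (C := M)
      (fun x hx => ((hf x (hsub hx)).fderiv_right (m := 1) (by norm_num)).differentiableAt
        (by norm_num)) (fun x hx => hhess x (hsub hx)) (convex_ball z s) hzs hy).trans ?_
    gcongr
    exact (mem_ball_iff_norm.1 hy).le
  have hmv := Convex.norm_image_sub_le_of_norm_fderiv_le' (𝕜 := ℝ) (s := Metric.ball z s)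
    (fun x hx => (hf x (hsub hx)).differentiableAt (by norm_num)) hlip (convex_ball z s) hzs hmem
  rw [add_sub_cancel_left, map_smul, smul_eq_mul] at hmv
  have h1 := (abs_le.1 hmv).1
  have h2 := hneg _ (hsub hmem)
  have h3 : M * s ≤ c / 4 := by
    rw [le_div_iff₀ (by positivity)] at hsM
    linarith
  have h4 : M * s * ‖s • v‖ ≤ c / 4 * s := by gcongr
  nlinarith

end Geometry

section Perturbation

variable {n : ℕ}

theorem complexSq_sub_le {l l' : EuclideanSpace ℂ (Fin n) →L[ℝ] ℝ} {M e : ℝ} (hl : ‖l‖ ≤ M)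
    (hl' : ‖l'‖ ≤ M) (he : ‖l - l'‖ ≤ e) (t : EuclideanSpace ℂ (Fin n)) :
    complexSq l' t - 4 * M * e * ‖t‖ ^ 2 ≤ complexSq l t := by
  have key : ∀ v : EuclideanSpace ℂ (Fin n), ‖v‖ = ‖t‖ →
      l' v ^ 2 - 2 * M * e * ‖t‖ ^ 2 ≤ l v ^ 2 := by
    intro v hv
    have he0 : 0 ≤ e := (norm_nonneg _).trans he
    have h1 : |l v - l' v| ≤ e * ‖t‖ := by
      have := ((l - l').le_opNorm v).trans (mul_le_mul_of_nonneg_right he (norm_nonneg v))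
      rwa [hv] at this
    have h2 : |l v + l' v| ≤ 2 * M * ‖t‖ := by
      have hsum : ‖l + l'‖ ≤ 2 * M := (norm_add_le _ _).trans (by linarith)
      have := ((l + l').le_opNorm v).trans (mul_le_mul_of_nonneg_right hsum (norm_nonneg v))
      rwa [hv] at this
    have h3 : |(l v - l' v) * (l v + l' v)| ≤ e * ‖t‖ * (2 * M * ‖t‖) := by
      rw [abs_mul]
      gcongr
    nlinarith [(abs_le.1 h3).1]
  have h1 := key t rfl
  have h2 := key (Complex.I • t) (by rw [norm_smul, Complex.norm_I, one_mul])
  rw [complexSq, complexSq]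
  linarith

theorem hermitianPart_sub_le {H H' : EuclideanSpace ℂ (Fin n) →L[ℝ]
    EuclideanSpace ℂ (Fin n) →L[ℝ] ℝ} {e : ℝ} (he : ‖H - H'‖ ≤ e)
    (t : EuclideanSpace ℂ (Fin n)) :
    hermitianPart H' t - 2 * e * ‖t‖ ^ 2 ≤ hermitianPart H t := by
  have key : ∀ v : EuclideanSpace ℂ (Fin n), ‖v‖ = ‖t‖ → H' v v - e * ‖t‖ ^ 2 ≤ H v v := by
    intro v hv
    have h1 : |H v v - H' v v| ≤ e * ‖t‖ * ‖t‖ := by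
      have := ((H - H').le_opNorm₂ v v).trans
        (by gcongr : ‖H - H'‖ * ‖v‖ * ‖v‖ ≤ e * ‖v‖ * ‖v‖)
      rwa [hv] at this
    nlinarith [(abs_le.1 h1).1]
  have h1 := key t rfl
  have h2 := key (Complex.I • t) (by rw [norm_smul, Complex.norm_I, one_mul])
  rw [hermitianPart, hermitianPart]
  linarith

set_option maxSynthPendingDepth 3 in
theorem hermitianPart_add_complexSq_ge_of_near {ρ : EuclideanSpace ℂ (Fin n) → ℝ}
    {p z : EuclideanSpace ℂ (Fin n)} {η M K κ d : ℝ} (hM : 0 ≤ M) (hK : 0 ≤ K)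
    (hC : ∀ y ∈ Metric.ball p η, ContDiffAt ℝ 3 ρ y)
    (hb : ∀ k ≤ 3, ∀ y ∈ Metric.ball p η, ‖iteratedFDeriv ℝ k ρ y‖ ≤ M)
    (hz : z ∈ Metric.ball p η) (hzd : dist z p ≤ d) (hd : (2 * M + 4 * K * M ^ 2) * d ≤ κ)
    {t : EuclideanSpace ℂ (Fin n)}
    (h : 2 * κ * ‖t‖ ^ 2 ≤ hermitianPart (fderiv ℝ (fderiv ℝ ρ) p) t
      + K * complexSq (fderiv ℝ ρ p) t) :
    κ * ‖t‖ ^ 2 ≤ hermitianPart (fderiv ℝ (fderiv ℝ ρ) z) t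
      + K * complexSq (fderiv ℝ ρ z) t := by
  have hp : p ∈ Metric.ball p η := Metric.mem_ball_self (dist_nonneg.trans_lt (Metric.mem_ball.1 hz))
  have hlip1 : ‖fderiv ℝ ρ z - fderiv ℝ ρ p‖ ≤ M * d := by
    refine (Convex.norm_image_sub_le_of_norm_fderiv_le (𝕜 := ℝ) (s := Metric.ball p η) (C := M)
      (fun x hx => ((hC x hx).fderiv_right (m := 2) (by norm_num)).differentiableAt
        (by norm_num)) (fun x hx => ?_) (convex_ball p η) hp hz).trans ?_
    · rw [norm_fderiv_fderiv]; exact hb 2 (by norm_num) x hx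
    · rw [← dist_eq_norm]; gcongr
  have hlip2 : ‖fderiv ℝ (fderiv ℝ ρ) z - fderiv ℝ (fderiv ℝ ρ) p‖ ≤ M * d := by
    refine (Convex.norm_image_sub_le_of_norm_fderiv_le (𝕜 := ℝ) (s := Metric.ball p η) (C := M)
      (fun x hx => (((hC x hx).fderiv_right (m := 2) (by norm_num)).fderiv_right (m := 1)
        (by norm_num)).differentiableAt (by norm_num)) (fun x hx => ?_) (convex_ball p η) hp
        hz).trans ?_
    · rw [norm_fderiv_fderiv_fderiv]; exact hb 3 le_rfl x hx
    · rw [← dist_eq_norm]; gcongr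
  have hn : ∀ y ∈ Metric.ball p η, ‖fderiv ℝ ρ y‖ ≤ M := fun y hy => by
    rw [← norm_iteratedFDeriv_one]; exact hb 1 (by norm_num) y hy
  have h1 := complexSq_sub_le (hn z hz) (hn p hp) hlip1 t
  have h2 := hermitianPart_sub_le hlip2 t
  have h3 := mul_le_mul_of_nonneg_left h1 hK
  have h4 := mul_le_mul_of_nonneg_right hd (sq_nonneg ‖t‖)
  nlinarith

end Perturbation

theorem IsDefiningFunction.quarticCutoff_comp {n m : ℕ} (hm : 1 ≤ m) (hm' : m ≤ 3)
    {Ω V : Set (EuclideanSpace ℂ (Fin n))} (hΩ : IsOpen Ω) {ρ : EuclideanSpace ℂ (Fin n) → ℝ}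
    (h : IsDefiningFunction m Ω V ρ) {a : ℝ} (ha : 0 < a) :
    IsDefiningFunction m Ω V fun z => quarticCutoff a (ρ z) where
  isOpen := h.isOpen
  frontier_subset := h.frontier_subset
  contDiffOn := ((contDiff_quarticCutoff a).of_le (by exact_mod_cast hm')).comp_contDiffOn
    h.contDiffOn
  neg_eq := by simpa only [quarticCutoff_neg_iff ha] using h.neg_eq
  fderiv_ne_zero := fun x hx => by
    rw [fderiv_comp_eq_smul (hasDerivAt_quarticCutoff a)
      ((h.contDiffAt (h.frontier_subset hx)).differentiableAt (by norm_cast; omega)),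
      h.eq_zero hΩ hx, zero_add, max_eq_left ha.le]
    exact smul_ne_zero (by positivity) (h.fderiv_ne_zero x hx)

section Main

variable {n m : ℕ} {Ω U₀ V : Set (EuclideanSpace ℂ (Fin n))}
  {r ρ : EuclideanSpace ℂ (Fin n) → ℝ}

theorem IsUniformDefiningFunction.exists_coercive (hΩ : IsOpen Ω)
    (hr : IsDefiningFunction 2 Ω U₀ r) {C : ℝ} (hC : 0 < C)
    (hLevi : ∀ p ∈ frontier Ω, ∀ t : EuclideanSpace ℂ (Fin n), IsComplexTangent r p t →
      C * ‖fderiv ℝ r p‖ * ∑ j, ‖t j‖ ^ 2 ≤ leviForm r p t)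
    (hm : 2 ≤ m) (h : IsUniformDefiningFunction m Ω V ρ) :
    ∃ K > 0, ∃ κ > 0, ∀ p ∈ frontier Ω, ∀ t, κ * ‖t‖ ^ 2 ≤
      hermitianPart (fderiv ℝ (fderiv ℝ ρ) p) t + K * complexSq (fderiv ℝ ρ p) t := by
  obtain ⟨M, hM, hb⟩ := h.exists_bound
  obtain ⟨c, hc, hgrad⟩ := h.gradient_bound
  obtain ⟨K, hK, hcoer⟩ := exists_hermitianPart_add_complexSq_ge (n := n) hM hc (mul_pos hC hc)
  refine ⟨K, hK, C * c, mul_pos hC hc, fun p hp t => ?_⟩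
  have hpV := h.frontier_subset hp
  refine hcoer _ _ (hgrad p hpV) ?_ (fun t ht ht' => ?_) t
  · rw [norm_fderiv_fderiv]; exact hb 2 hm p hpV
  · refine le_trans ?_ (hermitianPart_ge_of_leviForm_ge hΩ hr
      (h.toIsDefiningFunction.of_le hm) hp (hLevi p hp) t ht ht')
    gcongr
    exact hgrad p hpV

theorem IsUniformDefiningFunction.exists_strictlyPlurisubharmonicOn_frontier (hΩ : IsOpen Ω)
    (hr : IsDefiningFunction 2 Ω U₀ r) {C : ℝ} (hC : 0 < C)
    (hLevi : ∀ p ∈ frontier Ω, ∀ t : EuclideanSpace ℂ (Fin n), IsComplexTangent r p t →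
      C * ‖fderiv ℝ r p‖ * ∑ j, ‖t j‖ ^ 2 ≤ leviForm r p t)
    (h : IsUniformDefiningFunction 2 Ω V ρ) :
    ∃ U σ, IsDefiningFunction 2 Ω U σ ∧ IsStrictlyPlurisubharmonicOn σ (frontier Ω) := by
  obtain ⟨K, hK, κ, hκ, hcoer⟩ := h.exists_coercive hΩ hr hC hLevi le_rfl
  have ha : 0 < 3 / K := by positivity
  have hdef := h.toIsDefiningFunction.quarticCutoff_comp (by norm_num) (by norm_num) hΩ ha
  refine ⟨V, _, hdef, fun p hp => hdef.contDiffAt (hdef.frontier_subset hp), fun p hp t ht => ?_⟩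
  have hmax : max (ρ p + 3 / K) 0 = 3 / K := by
    rw [h.eq_zero hΩ hp, zero_add, max_eq_left ha.le]
  refine lt_of_lt_of_le ?_ (le_leviForm_quarticCutoff_comp
    (h.contDiffAt (h.frontier_subset hp)) (by rw [hmax, mul_div_cancel₀ _ hK.ne']) (hcoer p hp t))
  rw [hmax]
  have := norm_pos_iff.2 ht
  positivity

theorem IsUniformDefiningFunction.exists_plurisubharmonicOn (hΩ : IsOpen Ω)
    (hr : IsDefiningFunction 2 Ω U₀ r) {C : ℝ} (hC : 0 < C)
    (hLevi : ∀ p ∈ frontier Ω, ∀ t : EuclideanSpace ℂ (Fin n), IsComplexTangent r p t →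
      C * ‖fderiv ℝ r p‖ * ∑ j, ‖t j‖ ^ 2 ≤ leviForm r p t)
    (h : IsUniformDefiningFunction 3 Ω V ρ) :
    ∃ U σ, IsDefiningFunction 3 Ω U σ ∧ Ω ⊆ U ∧ IsPlurisubharmonicOn σ Ω ∧
      ∃ ε : ℝ, 0 < ε ∧ IsStrictlyPlurisubharmonicOn σ
        {z | z ∈ Ω ∧ Metric.infEDist z (frontier Ω) < ENNReal.ofReal ε} := by
  classical
  obtain ⟨K, hK, κ, hκ, hcoer⟩ := h.exists_coercive hΩ hr hC hLevi (by norm_num)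
  obtain ⟨M, hM, hb⟩ := h.exists_bound
  obtain ⟨c, hc, hgrad⟩ := h.gradient_bound
  obtain ⟨η, hη, hball⟩ := h.exists_ball_subset
  obtain ⟨d, hd, hdη, hdκ⟩ :
      ∃ d > 0, d ≤ η / 2 ∧ (2 * M + 4 * K * M ^ 2) * d ≤ κ / 2 := by
    have hD : 0 < 2 * M + 4 * K * M ^ 2 := by positivity
    refine ⟨min (η / 2) (κ / 2 / (2 * M + 4 * K * M ^ 2)), by positivity, min_le_left _ _, ?_⟩
    rw [← le_div_iff₀' hD]
    exact min_le_right _ _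
  obtain ⟨s, hs, hsd, hsM⟩ : ∃ s > 0, s ≤ d / 2 ∧ s ≤ c / (4 * M) :=
    ⟨min (d / 2) (c / (4 * M)), by positivity, min_le_left _ _, min_le_right _ _⟩
  obtain ⟨a, ha, haK, has⟩ : ∃ a > 0, a ≤ 3 / K ∧ a ≤ s * c / 4 :=
    ⟨min (3 / K) (s * c / 4), by positivity, min_le_left _ _, min_le_right _ _⟩
  set T := Metric.thickening d (frontier Ω) with hT
  have hTo : IsOpen T := Metric.isOpen_thickening
  have hfT : frontier Ω ⊆ T := Metric.self_subset_thickening hd _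
  have hnear : ∀ z ∈ T, ∃ p ∈ frontier Ω, dist z p < d := fun z hz =>
    Metric.mem_thickening_iff.1 hz
  have hTV : T ⊆ V := fun z hz => by
    obtain ⟨p, hp, hzp⟩ := hnear z hz
    exact hball p hp (Metric.mem_ball.2 (by linarith))
  have hdefT : IsDefiningFunction 3 Ω T ρ :=
    { isOpen := hTo
      frontier_subset := hfT
      contDiffOn := h.contDiffOn.mono hTV
      neg_eq := by
        ext x
        constructor
        · rintro ⟨hx, hx'⟩; exact ⟨(h.lt_zero_iff (hTV hx)).1 hx', hx⟩
        · rintro ⟨hx, hx'⟩; exact ⟨hx', (h.lt_zero_iff (hTV hx')).2 hx⟩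
      fderiv_ne_zero := h.fderiv_ne_zero }
  have hdef := hdefT.quarticCutoff_comp (by norm_num) le_rfl hΩ ha
  have hpos : ∀ z ∈ T, ∀ t, κ / 2 * ‖t‖ ^ 2 ≤
      hermitianPart (fderiv ℝ (fderiv ℝ ρ) z) t + K * complexSq (fderiv ℝ ρ z) t := by
    intro z hz t
    obtain ⟨p, hp, hzp⟩ := hnear z hz
    refine hermitianPart_add_complexSq_ge_of_near (η := η) hM.le hK.le
      (fun y hy => h.contDiffAt (hball p hp hy)) (fun k hk y hy => hb k hk y (hball p hp hy))
      (Metric.mem_ball.2 (by linarith)) hzp.le hdκ ?_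
    rw [mul_div_cancel₀ _ (by norm_num)]
    exact hcoer p hp t
  have hdeep : ∀ z ∈ Ω, z ∈ T → z ∉ Metric.thickening (d / 2) (frontier Ω) → ρ z ≤ -a := by
    intro z hz hzT hzd
    obtain ⟨p, hp, hzp⟩ := hnear z hzT
    have hsubV : Metric.ball z (d / 2) ⊆ V :=
      (Metric.ball_subset_ball' (by linarith)).trans (hball p hp)
    have hsubΩ : Metric.ball z (d / 2) ⊆ Ω := by
      refine ball_subset_of_disjoint_frontier hΩ hz fun y hy => ?_
      by_contra! hlt
      exact hzd (Metric.mem_thickening_iff.2 ⟨y, hy, by rwa [dist_comm]⟩)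
    have := le_of_forall_ball_neg hc hM hs hsd hsM
      (fun y hy => (h.contDiffAt (hsubV hy)).of_le (by norm_num))
      (fun y hy => (h.lt_zero_iff (hsubV hy)).2 (hsubΩ hy)) (hgrad z (hTV hzT))
      (fun y hy => by rw [norm_fderiv_fderiv]; exact hb 2 (by norm_num) y (hsubV hy))
    linarith
  set σ : EuclideanSpace ℂ (Fin n) → ℝ :=
    fun z => if z ∈ T then quarticCutoff a (ρ z) else -a ^ 4 with hσ
  have hσT : ∀ z ∈ T, σ =ᶠ[nhds z] fun z => quarticCutoff a (ρ z) := fun z hz => by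
    filter_upwards [hTo.mem_nhds hz] with y hy using if_pos hy
  have hσΩ : ∀ z ∈ Ω, z ∉ T → σ =ᶠ[nhds z] fun _ => -a ^ 4 := fun z hz hzT => by
    have hzc : z ∉ Metric.cthickening (d / 2) (frontier Ω) := fun hmem =>
      hzT (Metric.cthickening_subset_thickening' hd (by linarith) _ hmem)
    filter_upwards [hΩ.mem_nhds hz,
      Metric.isClosed_cthickening.isOpen_compl.mem_nhds hzc] with y hy hyc
    by_cases hyT : y ∈ T
    · rw [hσ]
      simp only [if_pos hyT]
      exact quarticCutoff_of_le (hdeep y hy hyT fun hmem =>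
        hyc (Metric.thickening_subset_cthickening _ _ hmem))
    · exact if_neg hyT
  have hσC : ∀ z ∈ Ω ∪ T, ContDiffAt ℝ 3 σ z := by
    intro z hz
    by_cases hzT : z ∈ T
    · exact (hdef.contDiffAt hzT).congr_of_eventuallyEq (hσT z hzT)
    · exact contDiffAt_const.congr_of_eventuallyEq (hσΩ z (hz.resolve_right hzT) hzT)
  have hσC2 : ∀ z ∈ Ω, ContDiffAt ℝ 2 σ z := fun z hz =>
    (hσC z (Or.inl hz)).of_le (by norm_num)
  have hleviT : ∀ z ∈ Ω, z ∈ T → ∀ t,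
      max (ρ z + a) 0 ^ 3 * (κ / 2 * ‖t‖ ^ 2) ≤ leviForm σ z t := by
    intro z hz hzT t
    have hneg := (h.lt_zero_iff (hTV hzT)).2 hz
    have hmax : max (ρ z + a) 0 ≤ 3 / K := max_le (by linarith) (by positivity)
    rw [le_div_iff₀' hK] at hmax
    have hC2 : ContDiffAt ℝ 2 (fun z => quarticCutoff a (ρ z)) z :=
      (hdef.contDiffAt hzT).of_le (by norm_num)
    rw [leviForm_eq (hσC2 z hz), (hσT z hzT).fderiv.fderiv_eq, ← leviForm_eq hC2]
    exact le_leviForm_quarticCutoff_comp ((h.contDiffAt (hTV hzT)).of_le (by norm_num)) hmax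
      (hpos z hzT t)
  refine ⟨Ω ∪ T, σ, ⟨hΩ.union hTo, fun z hz => Or.inr (hfT hz),
    fun z hz => (hσC z hz).contDiffWithinAt, ?_, ?_⟩, Set.subset_union_left,
    ⟨hσC2, fun z hz t => ?_⟩, min d (a / M), by positivity, fun z hz => hσC2 z hz.1, ?_⟩
  · ext x
    by_cases hx : x ∈ T
    · have : σ x = quarticCutoff a (ρ x) := if_pos hx
      simp [this, hx, quarticCutoff_neg_iff ha, h.lt_zero_iff (hTV hx)]
    · have : σ x = -a ^ 4 := if_neg hx
      simp [this, hx, ha]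
  · intro x hx
    rw [(hσT x (hfT hx)).fderiv_eq]
    exact hdef.fderiv_ne_zero x hx
  · by_cases hzT : z ∈ T
    · refine le_trans ?_ (hleviT z hz hzT t)
      have : 0 ≤ max (ρ z + a) 0 := le_max_right _ _
      positivity
    · rw [leviForm_eq (hσC2 z hz), (hσΩ z hz hzT).fderiv.fderiv_eq]
      simp [hermitianPart]
  · rintro z ⟨hz, hzε⟩ t ht
    obtain ⟨p, hp, hzp⟩ := Metric.mem_thickening_iff.1 (Metric.mem_thickening_iff_infEDist_lt.2 hzε)
    have hzT : z ∈ T := Metric.mem_thickening_iff.2 ⟨p, hp, hzp.trans_le (min_le_left _ _)⟩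
    refine lt_of_lt_of_le ?_ (hleviT z hz hzT t)
    have hzd : dist z p < d := hzp.trans_le (min_le_left _ _)
    have hza : M * dist z p < a := by
      rw [← lt_div_iff₀' hM]
      exact hzp.trans_le (min_le_right _ _)
    have hlip : ‖ρ z - ρ p‖ ≤ M * ‖z - p‖ :=
      Convex.norm_image_sub_le_of_norm_fderiv_le (𝕜 := ℝ) (s := Metric.ball p η)
        (fun x hx => (h.contDiffAt (hball p hp hx)).differentiableAt (by norm_num))
        (fun x hx => by
          rw [← norm_iteratedFDeriv_one]; exact hb 1 (by norm_num) x (hball p hp hx))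
        (convex_ball p η) (Metric.mem_ball_self hη) (Metric.mem_ball.2 (by linarith))
    rw [h.eq_zero hΩ hp, sub_zero, ← dist_eq_norm] at hlip
    have hlow := (abs_le.1 hlip).1
    have h1 : 0 < max (ρ z + a) 0 := lt_max_of_lt_left (by linarith)
    have h2 := norm_pos_iff.2 ht
    positivity

end Main

theorem mainTheorem4 {n : ℕ} (Ω : Set (EuclideanSpace ℂ (Fin n))) (hΩ : IsOpen Ω)
    (U₀ : Set (EuclideanSpace ℂ (Fin n))) (r : EuclideanSpace ℂ (Fin n) → ℝ)
    (hr : IsDefiningFunction 2 Ω U₀ r) (C : ℝ) (hC : 0 < C)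
    (hLevi : ∀ p ∈ frontier Ω, ∀ t : EuclideanSpace ℂ (Fin n), IsComplexTangent r p t →
      C * ‖fderiv ℝ r p‖ * ∑ j, ‖t j‖ ^ 2 ≤ leviForm r p t) :
    ((∃ V ρ₀, IsUniformDefiningFunction 2 Ω V ρ₀) →
      ∃ U ρ, IsDefiningFunction 2 Ω U ρ ∧ IsStrictlyPlurisubharmonicOn ρ (frontier Ω)) ∧
    ((∃ V ρ₀, IsUniformDefiningFunction 3 Ω V ρ₀) →
      ∃ U ρ, IsDefiningFunction 3 Ω U ρ ∧ Ω ⊆ U ∧ IsPlurisubharmonicOn ρ Ω ∧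
        ∃ ε : ℝ, 0 < ε ∧ IsStrictlyPlurisubharmonicOn ρ
          {z | z ∈ Ω ∧ Metric.infEDist z (frontier Ω) < ENNReal.ofReal ε}) := by
  constructor
  · rintro ⟨V, ρ₀, h⟩
    exact h.exists_strictlyPlurisubharmonicOn_frontier hΩ hr hC hLevi
  · rintro ⟨V, ρ₀, h⟩
    exact h.exists_plurisubharmonicOn hΩ hr hC hLevi
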